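/- An mm-space is a triple $X=(X,d_X,\mu_X)$ where $(X,d_X)$ is a complete separable metric space and $\mu_X$ is a Borel probability measure on it. For mm-spaces $X,Y$ and $\varepsilon>0$: - $Y\prec X$ ($X$ dominates $Y$) means that there is a $1$-Lipschitz map $f:X\to Y$ with $f_*\mu_X=\mu_Y$. - $Y\prec_\varepsilon X$ means that there are a Borel set $\tilde X\subset X$ and a Borel map $f:X\to Y$ with $\mu_X(\tilde X)\ge 1-\varepsilon$, with $d_Y(f(x),f(x'))\le d_X(x,x')+\varepsilon$ for all $x,x'\in\tilde X$, and with $d_P(f_*\mu_X,\mu_Y)\le\varepsilon$, where $d_P$ is the Prokhorov distance. - The box distance $\Box(X,Y)$ is the infimum of all $\varepsilon\ge 0$ for which there are Borel maps $\varphi:[0,1)\to X$ and $\psi:[0,1)\to Y$ pushing Lebesgue measure $\mathcal L^1$ forward to $\mu_X$ and $\mu_Y$ respectively, and a Borel set $I_0\subset[0,1)$ with $\mathcal L^1(I_0)\ge 1-\varepsilon$ and $|d_X(\varphi(s),\varphi(t))-d_Y(\psi(s),\psi(t))|\le\varepsilon$ for all $s,t\in I_0$. A set $\mathcal Y$ of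 mm-spaces is called $\Box$-precompact if its closure in the space of all mm-spaces, with the topology of the box distance, is compact. **Corollary 3.12.** For any set $\mathcal Y$ of mm-spaces, the following are equivalent. 1. There exists an mm-space $X$ with $Y\prec X$ for every $Y\in\mathcal Y$. 2. For every $\varepsilon>0$ there exists an mm-space $X$ with $Y\prec_\varepsilon X$ for every $Y\in\mathcal Y$. 3. $\mathcal Y$ is $\Box$-precompact. -/

import Mathlib

open MeasureTheory Set

universe u

/-- A metric measure space: a complete separable metric space with a Borel probability measure. -/
structure MMSpace : Type (u + 1) where
  carrier : Type u
  [metricSpace : MetricSpace carrier]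
  [completeSpace : CompleteSpace carrier]
  [separableSpace : TopologicalSpace.SeparableSpace carrier]
  [measurableSpace : MeasurableSpace carrier]
  [borelSpace : BorelSpace carrier]
  μ : Measure carrier
  [isProbabilityMeasure : IsProbabilityMeasure μ]

namespace MMSpace

instance : CoeSort MMSpace.{u} (Type u) := ⟨MMSpace.carrier⟩

attribute [instance] metricSpace completeSpace separableSpace measurableSpace borelSpace
  isProbabilityMeasure

/-- `Y ≺ X`: there is a `1`-Lipschitz map `X → Y` pushing `μ_X` forward to `μ_Y`. -/
def Dominates (X Y : MMSpace.{u}) : Prop :=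
  ∃ f : X → Y, LipschitzWith 1 f ∧ X.μ.map f = Y.μ

/-- `Y ≺_ε X`, with non-exceptional domain `D`. -/
def AlmostDominates (ε : ℝ) (X Y : MMSpace.{u}) : Prop :=
  ∃ (D : Set X) (f : X → Y), MeasurableSet D ∧ Measurable f ∧
    1 - ε ≤ X.μ.real D ∧
    (∀ x ∈ D, ∀ x' ∈ D, dist (f x) (f x') ≤ dist x x' + ε) ∧
    levyProkhorovDist (X.μ.map f) Y.μ ≤ ε

/-- Lebesgue measure on `[0,1)`. -/
noncomputable def lebesgueIco : Measure (Ico (0 : ℝ) 1) :=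
  (volume : Measure ℝ).comap Subtype.val

/-- A parameter of `X`: a Borel map `[0,1) → X` pushing Lebesgue measure forward to `μ_X`. -/
def IsParameter (X : MMSpace.{u}) (φ : Ico (0 : ℝ) 1 → X) : Prop :=
  MeasurePreserving φ lebesgueIco X.μ

/-- The box distance: the infimum of all `ε ≥ 0` for which there are parameters `φ`, `ψ` of `X`,
`Y` and a Borel set `J ⊆ [0,1)` of measure at least `1 - ε` on which the pulled back distances
differ by at most `ε`. (The value `ε = 1` is always admissible.) -/
noncomputable def box (X Y : MMSpace.{u}) : ℝ :=
  sInf {ε : ℝ | 0 ≤ ε ∧ ∃ (φ : Ico (0 : ℝ) 1 → X) (ψ : Ico (0 : ℝ) 1 → Y)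
    (J : Set (Ico (0 : ℝ) 1)), X.IsParameter φ ∧ Y.IsParameter ψ ∧ MeasurableSet J ∧
      1 - ε ≤ lebesgueIco.real J ∧
      ∀ s ∈ J, ∀ t ∈ J, |dist (φ s) (φ t) - dist (ψ s) (ψ t)| ≤ ε}

/-- The topology of the box distance: a set is open if it contains a `□`-ball around each of its
points. -/
instance boxTopology : TopologicalSpace MMSpace.{u} where
  IsOpen U := ∀ X ∈ U, ∃ ε > 0, ∀ Y, box X Y < ε → Y ∈ U
  isOpen_univ := fun _ _ => ⟨1, one_pos, fun _ _ => mem_univ _⟩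
  isOpen_inter := fun U V hU hV X hX => by
    obtain ⟨a, ha, hUa⟩ := hU X hX.1
    obtain ⟨b, hb, hVb⟩ := hV X hX.2
    exact ⟨min a b, lt_min ha hb, fun Y hY =>
      ⟨hUa Y (hY.trans_le (min_le_left _ _)), hVb Y (hY.trans_le (min_le_right _ _))⟩⟩
  isOpen_sUnion := fun S hS X ⟨U, hU, hX⟩ => by
    obtain ⟨a, ha, h⟩ := hS U hU X hX
    exact ⟨a, ha, fun Y hY => ⟨U, hU, h Y hY⟩⟩

/-- `□`-precompactness: the closure with respect to the box distance is compact. -/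
def IsBoxPrecompact (𝒴 : Set MMSpace.{u}) : Prop :=
  IsCompact (closure 𝒴)

end MMSpace

namespace MMSpace
open ProbabilityTheory Filter Topology Metric

/-! All three conditions are tied to one quantitative property, `HasUniformNets`. A single mm-space
has a finite net at every scale, and nets survive both box-closeness and almost domination with
slightly worse constants. Hence (2) gives uniform nets directly, and (3) gives them through a finite
cover by small balls.

Conversely, uniform nets give a common dominating space. Each `Y` gets a parameter `φ_Y` on almost
all of `[0,1)` whose oscillation on mixed radix intervals is bounded independently of `Y`. Then
`ρ(x,y) = sup_Y d(φ_Y x, φ_Y y)` is a finite separable pseudodistance, and every `φ_Y` factors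
through a 1-Lipschitz map from its completion (`exists_dominates_of_maps`). To build `φ_Y`, `μ_Y` is
cut repeatedly into pieces of equal mass, most of them inside one net set (`exists_measure_split`).
By Borel–Cantelli almost every point eventually has only good digits, so the supports of its pieces
shrink to a point, the value of `φ_Y` (`IsMeasureTree.exists_map`).

For (1) → (3), a space dominated by `X` is, up to box distance zero, `X` with a smaller
pseudodistance. Such pseudodistances form a compact set for pointwise convergence and map
continuously to the box topology. -/

/-! ### The box distance is a pseudometric -/

instance : IsProbabilityMeasure lebesgueIco := ⟨by
  rw [lebesgueIco, (MeasurableEmbedding.subtype_coe measurableSet_Ico).comap_apply,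
    image_univ, Subtype.range_coe, Real.volume_Ico]
  simp⟩

lemma one_sub_add_le_measureReal_inter {Ω : Type*} [MeasurableSpace Ω] {P : Measure Ω}
    [IsProbabilityMeasure P] {S T : Set Ω} (hT : MeasurableSet T) {ε δ : ℝ}
    (h₁ : 1 - ε ≤ P.real S) (h₂ : 1 - δ ≤ P.real T) : 1 - (ε + δ) ≤ P.real (S ∩ T) := by
  have := measureReal_union_add_inter (μ := P) (s := S) hT
  have : P.real (S ∪ T) ≤ 1 := measureReal_le_one
  linarith

/-- Every probability measure on a standard Borel space is an image of Lebesgue measure on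
`[0,1)`. -/
lemma exists_measurePreserving_lebesgueIco {Ω : Type*} [MeasurableSpace Ω] [StandardBorelSpace Ω]
    (P : Measure Ω) [IsProbabilityMeasure P] :
    ∃ θ : Ico (0 : ℝ) 1 → Ω, MeasurePreserving θ lebesgueIco P := by
  have : Nonempty Ω := nonempty_of_isProbabilityMeasure P
  obtain ⟨f, hf, hfP⟩ := P.exists_measurable_map_eq
  let i : Ico (0 : ℝ) 1 → unitInterval := fun x => ⟨x.1, x.2.1, x.2.2.le⟩
  have hi : Measurable i := measurable_subtype_coe.subtype_mk
  refine ⟨f ∘ i, hf.comp hi, ?_⟩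
  rw [← hfP, ← Measure.map_map hf hi]
  congr 1
  ext s hs
  rw [Measure.map_apply hi hs, lebesgueIco,
    (MeasurableEmbedding.subtype_coe measurableSet_Ico).comap_apply,
    Measure.Subtype.volume_def,
    (MeasurableEmbedding.subtype_coe measurableSet_Icc).comap_apply]
  refine measure_congr ?_
  have h1 : ∀ᵐ x : ℝ, x ≠ 1 := by simp [ae_iff]
  filter_upwards [h1] with x hx
  refine propext ⟨?_, ?_⟩
  · rintro ⟨y, hy, rfl⟩
    exact ⟨i y, hy, rfl⟩
  · rintro ⟨y, hy, rfl⟩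
    exact ⟨⟨y.1, y.2.1, lt_of_le_of_ne y.2.2 hx⟩, hy, rfl⟩

lemma box_nonneg (X Y : MMSpace.{u}) : 0 ≤ box X Y :=
  Real.sInf_nonneg fun _ h => h.1

/-- A coupling with small distortion on a large set bounds the box distance. -/
lemma box_le_of_measurePreserving {X Y : MMSpace.{u}} {Ω : Type*} [MeasurableSpace Ω]
    [StandardBorelSpace Ω] {P : Measure Ω} [IsProbabilityMeasure P] {a : Ω → X} {b : Ω → Y}
    (ha : MeasurePreserving a P X.μ) (hb : MeasurePreserving b P Y.μ) {S : Set Ω}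
    (hS : MeasurableSet S) {ε : ℝ} (hε : 0 ≤ ε) (hPS : 1 - ε ≤ P.real S)
    (h : ∀ s ∈ S, ∀ t ∈ S, |dist (a s) (a t) - dist (b s) (b t)| ≤ ε) : box X Y ≤ ε := by
  obtain ⟨θ, hθ⟩ := exists_measurePreserving_lebesgueIco P
  refine csInf_le ⟨0, fun _ h => h.1⟩ ⟨hε, a ∘ θ, b ∘ θ, θ ⁻¹' S, ha.comp hθ, hb.comp hθ,
    hθ.measurable hS, ?_, fun s hs t ht => h _ hs _ ht⟩
  rwa [measureReal_def, hθ.measure_preimage hS.nullMeasurableSet]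

lemma exists_parameters_of_box_lt {X Y : MMSpace.{u}} {ε : ℝ} (h : box X Y < ε) :
    ∃ (φ : Ico (0 : ℝ) 1 → X) (ψ : Ico (0 : ℝ) 1 → Y) (J : Set (Ico (0 : ℝ) 1)),
      X.IsParameter φ ∧ Y.IsParameter ψ ∧ MeasurableSet J ∧ 1 - ε ≤ lebesgueIco.real J ∧
      ∀ s ∈ J, ∀ t ∈ J, |dist (φ s) (φ t) - dist (ψ s) (ψ t)| ≤ ε := by
  obtain ⟨φ, hφ⟩ := exists_measurePreserving_lebesgueIco X.μ
  obtain ⟨ψ, hψ⟩ := exists_measurePreserving_lebesgueIco Y.μ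
  obtain ⟨δ, ⟨-, φ, ψ, J, hφ, hψ, hJ, h1, h2⟩, hδ⟩ := exists_lt_of_csInf_lt
    (by exact ⟨1, zero_le_one, φ, ψ, ∅, hφ, hψ, .empty, by simp, by simp⟩) h
  exact ⟨φ, ψ, J, hφ, hψ, hJ, by linarith, fun s hs t ht => (h2 s hs t ht).trans hδ.le⟩

lemma box_self (X : MMSpace.{u}) : box X X = 0 :=
  le_antisymm (box_le_of_measurePreserving (.id X.μ) (.id X.μ) .univ le_rfl (by simp) (by simp))
    (box_nonneg X X)

lemma box_comm (X Y : MMSpace.{u}) : box X Y = box Y X := by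
  have key : ∀ X Y : MMSpace.{u}, box X Y ≤ box Y X := fun X Y => by
    refine le_of_forall_gt_imp_ge_of_dense fun ε hε => ?_
    obtain ⟨φ, ψ, J, hφ, hψ, hJ, h1, h2⟩ := exists_parameters_of_box_lt hε
    exact csInf_le ⟨0, fun _ h => h.1⟩ ⟨(box_nonneg Y X).trans hε.le, ψ, φ, J, hψ, hφ, hJ, h1,
      fun s hs t ht => by rw [abs_sub_comm]; exact h2 s hs t ht⟩
  exact le_antisymm (key X Y) (key Y X)

/-- The joint law of two parameters is a coupling. The image of `J` need not be Borel; its closure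
is, and the distortion bound passes to it by continuity. -/
lemma exists_coupling_of_box_lt {X Y : MMSpace.{u}} {ε : ℝ} (h : box X Y < ε) :
    ∃ (π : Measure (X × Y)) (S : Set (X × Y)), IsProbabilityMeasure π ∧ π.fst = X.μ ∧
      π.snd = Y.μ ∧ IsClosed S ∧ 1 - ε ≤ π.real S ∧
      ∀ p ∈ S, ∀ q ∈ S, |dist p.1 q.1 - dist p.2 q.2| ≤ ε := by
  obtain ⟨φ, ψ, J, hφ, hψ, hJ, h1, h2⟩ := exists_parameters_of_box_lt h
  have hm : Measurable fun t => (φ t, ψ t) := hφ.measurable.prodMk hψ.measurable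
  have hπ : IsProbabilityMeasure (lebesgueIco.map fun t => (φ t, ψ t)) :=
    Measure.isProbabilityMeasure_map hm.aemeasurable
  refine ⟨lebesgueIco.map fun t => (φ t, ψ t), closure ((fun t => (φ t, ψ t)) '' J), hπ, ?_, ?_,
    isClosed_closure, h1.trans ?_, fun p hp q hq => ?_⟩
  · rw [Measure.fst_map_prodMk hψ.measurable, hφ.map_eq]
  · rw [Measure.snd_map_prodMk hφ.measurable, hψ.map_eq]
  · rw [map_measureReal_apply hm isClosed_closure.measurableSet]
    exact measureReal_mono fun t ht => subset_closure (mem_image_of_mem _ ht)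
  · have hc : Continuous fun r : (X × Y) × (X × Y) =>
        |dist r.1.1 r.2.1 - dist r.1.2 r.2.2| := by fun_prop
    have := map_mem_closure₂ (f := fun p q : X × Y => |dist p.1 q.1 - dist p.2 q.2|)
      (u := Iic ε) hc hp hq (by rintro _ ⟨s, hs, rfl⟩ _ ⟨t, ht, rfl⟩; exact h2 s hs t ht)
    rwa [isClosed_Iic.closure_eq] at this

/-- Gluing of two couplings along a common marginal. -/
lemma exists_gluing {α β γ : Type*} [MeasurableSpace α] [MeasurableSpace β] [MeasurableSpace γ]
    [StandardBorelSpace β] [StandardBorelSpace γ] (π₁ : Measure (α × β)) (π₂ : Measure (α × γ))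
    [IsProbabilityMeasure π₁] [IsProbabilityMeasure π₂] (h : π₁.fst = π₂.fst) :
    ∃ P : Measure (α × β × γ), IsProbabilityMeasure P ∧
      P.map (fun p => (p.1, p.2.1)) = π₁ ∧ P.map (fun p => (p.1, p.2.2)) = π₂ := by
  have : Nonempty β := (nonempty_of_isProbabilityMeasure π₁).map Prod.snd
  have : Nonempty γ := (nonempty_of_isProbabilityMeasure π₂).map Prod.snd
  refine ⟨π₁.fst ⊗ₘ (π₁.condKernel ×ₖ π₂.condKernel), inferInstance, ?_, ?_⟩
  · have := Measure.compProd_map (μ := π₁.fst) (κ := π₁.condKernel ×ₖ π₂.condKernel)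
      (measurable_fst : Measurable (Prod.fst : β × γ → β))
    rw [← Kernel.fst_eq, Kernel.fst_prod, π₁.disintegrate] at this
    exact this.symm
  · have := Measure.compProd_map (μ := π₁.fst) (κ := π₁.condKernel ×ₖ π₂.condKernel)
      (measurable_snd : Measurable (Prod.snd : β × γ → γ))
    rw [← Kernel.snd_eq, Kernel.snd_prod, h, π₂.disintegrate] at this
    rw [h]
    exact this.symm

/-- The two parameters of `Y` need not agree, so the couplings are glued along `Y`; exceptional
masses and distortions add up. -/
lemma box_triangle (X Y Z : MMSpace.{u}) : box X Z ≤ box X Y + box Y Z := by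
  have key : ∀ ε > box Y X, ∀ δ > box Y Z, box X Z ≤ ε + δ := by
    intro ε hε δ hδ
    have hε0 := (box_nonneg _ _).trans_lt hε
    have hδ0 := (box_nonneg _ _).trans_lt hδ
    obtain ⟨π₁, S, hπ₁, h1, h2, hS, hPS, hSd⟩ := exists_coupling_of_box_lt hε
    obtain ⟨π₂, T, hπ₂, h3, h4, hT, hPT, hTd⟩ := exists_coupling_of_box_lt hδ
    obtain ⟨P, hP, hP₁, hP₂⟩ := exists_gluing π₁ π₂ (h1.trans h3.symm)
    have m1 : Measurable fun p : Y × X × Z => (p.1, p.2.1) := by fun_prop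
    have m2 : Measurable fun p : Y × X × Z => (p.1, p.2.2) := by fun_prop
    have hS' := m1 hS.measurableSet
    have hT' := m2 hT.measurableSet
    refine box_le_of_measurePreserving (P := P) (a := fun p => p.2.1) (b := fun p => p.2.2)
      ⟨by fun_prop, ?_⟩ ⟨by fun_prop, ?_⟩ (hS'.inter hT') (by linarith) ?_ ?_
    · rw [← h2, ← hP₁, Measure.snd, Measure.map_map measurable_snd m1]; rfl
    · rw [← h4, ← hP₂, Measure.snd, Measure.map_map measurable_snd m2]; rfl
    · rw [← hP₁, map_measureReal_apply m1 hS.measurableSet] at hPS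
      rw [← hP₂, map_measureReal_apply m2 hT.measurableSet] at hPT
      exact one_sub_add_le_measureReal_inter hT' hPS hPT
    · rintro s ⟨hs1, hs2⟩ t ⟨ht1, ht2⟩
      have e1 := hSd _ hs1 _ ht1
      have e2 := hTd _ hs2 _ ht2
      simp only [abs_le] at e1 e2 ⊢
      constructor <;> linarith
  refine le_of_forall_pos_le_add fun η hη => ?_
  have := key (box Y X + η / 2) (by linarith) (box Y Z + η / 2) (by linarith)
  rw [box_comm X Y]
  linarith

/-- The box distance as a pseudometric inducing the box topology. -/
noncomputable instance : PseudoMetricSpace MMSpace.{u} :=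
  PseudoMetricSpace.ofDistTopology box box_self box_comm box_triangle fun _ => Iff.rfl

/-! ### Mm-spaces from pseudodistances -/

/-- A pseudodistance on a probability space whose small-oscillation measurable sets countably cover
the space is realized by an mm-space. -/
lemma exists_mmspace_of_pseudoDist {Ω : Type u} [MeasurableSpace Ω] (P : Measure Ω)
    [IsProbabilityMeasure P] (ρ : Ω → Ω → ℝ) (hself : ∀ x, ρ x x = 0)
    (hcomm : ∀ x y, ρ x y = ρ y x) (htri : ∀ x y z, ρ x z ≤ ρ x y + ρ y z)
    (hcover : ∀ ε > 0, ∃ A : ℕ → Set Ω, (∀ i, MeasurableSet (A i)) ∧ (∀ x, ∃ i, x ∈ A i) ∧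
      ∀ i, ∀ x ∈ A i, ∀ y ∈ A i, ρ x y ≤ ε) :
    ∃ (X : MMSpace.{u}) (q : Ω → X), MeasurePreserving q P X.μ ∧
      (∀ x y, dist (q x) (q y) = ρ x y) ∧
      ∀ (Y : Type u) [MetricSpace Y] [CompleteSpace Y] (f : Ω → Y),
        (∀ x y, dist (f x) (f y) ≤ ρ x y) →
          ∃ g : X → Y, LipschitzWith 1 g ∧ ∀ x, g (q x) = f x := by
  let _ : PseudoMetricSpace Ω :=
    { dist := ρ, dist_self := hself, dist_comm := hcomm, dist_triangle := htri }
  choose A hAm hAc hAρ using fun n : ℕ => hcover (1 / (n + 1)) (by positivity)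
  have small : ∀ (x : Ω) (U : Set Ω), IsOpen U → x ∈ U → ∃ n i, x ∈ A n i ∧ A n i ⊆ U := by
    intro x U hU hx
    obtain ⟨ε, hε, hb⟩ := Metric.isOpen_iff.1 hU x hx
    obtain ⟨n, hn⟩ := exists_nat_one_div_lt hε
    obtain ⟨i, hi⟩ := hAc n x
    exact ⟨n, i, hi, fun y hy => hb (mem_ball.2 ((hAρ n i y hy x hi).trans_lt hn))⟩
  -- An open set is the countable union of the covering sets it contains, so the new topology is
  -- compatible with the given σ-algebra.
  have hopen : OpensMeasurableSpace Ω := by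
    refine ⟨MeasurableSpace.generateFrom_le fun U hU => ?_⟩
    have : U = ⋃ (n) (i) (_ : A n i ⊆ U), A n i := by
      ext x
      simp only [mem_iUnion, exists_prop]
      refine ⟨fun hx => ?_, fun ⟨n, i, h, hx⟩ => h hx⟩
      obtain ⟨n, i, h1, h2⟩ := small x U hU hx
      exact ⟨n, i, h2, h1⟩
    rw [this]
    exact .iUnion fun n => .iUnion fun i => .iUnion fun _ => hAm n i
  have hne : Nonempty Ω := nonempty_of_isProbabilityMeasure P
  have hsep : TopologicalSpace.SeparableSpace Ω := by
    classical
    refine ⟨range fun p : ℕ × ℕ => if h : (A p.1 p.2).Nonempty then h.some else hne.some,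
      countable_range _, ?_⟩
    refine dense_iff_inter_open.2 fun U hU ⟨x, hx⟩ => ?_
    obtain ⟨n, i, h1, h2⟩ := small x U hU hx
    have h : (A n i).Nonempty := ⟨x, h1⟩
    exact ⟨h.some, h2 h.some_mem, (n, i), by simp [h]⟩
  -- The completion also identifies points at pseudodistance zero.
  let _ : MeasurableSpace (UniformSpace.Completion Ω) := borel _
  have : BorelSpace (UniformSpace.Completion Ω) := ⟨rfl⟩
  have hq : Measurable ((↑) : Ω → UniformSpace.Completion Ω) :=
    (UniformSpace.Completion.continuous_coe Ω).measurable
  have : IsProbabilityMeasure (P.map ((↑) : Ω → UniformSpace.Completion Ω)) :=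
    Measure.isProbabilityMeasure_map hq.aemeasurable
  refine ⟨{ carrier := UniformSpace.Completion Ω, μ := P.map (↑) }, fun x => (x : _), ⟨hq, rfl⟩,
    fun x y => UniformSpace.Completion.dist_eq x y, fun Y _ _ f hf => ?_⟩
  have hL : LipschitzWith 1 f := LipschitzWith.of_dist_le_mul fun x y => by
    rw [NNReal.coe_one, one_mul]; exact hf x y
  exact ⟨UniformSpace.Completion.extension f, hL.completion_extension,
    fun x => UniformSpace.Completion.extension_coe hL.uniformContinuous x⟩

/-! ### Uniform nets and their stability -/

/-- Up to measure `ε`, the space is covered by `n` closed sets of diameter at most `ε` with mutual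
distances at most `n`. -/
def HasNet (X : MMSpace.{u}) (ε : ℝ) (n : ℕ) : Prop :=
  ∃ C : ℕ → Set X, (∀ i, IsClosed (C i)) ∧ (∀ i, ∀ x ∈ C i, ∀ y ∈ C i, dist x y ≤ ε) ∧
    (∀ i, ∀ x ∈ C i, ∀ j, ∀ y ∈ C j, dist x y ≤ n) ∧ (∀ i, n ≤ i → C i = ∅) ∧
    1 - ε ≤ X.μ.real (⋃ i, C i)

/-- A family of mm-spaces with nets of uniformly bounded size at every scale. -/
def HasUniformNets (𝒴 : Set MMSpace.{u}) : Prop :=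
  ∀ ε : ℝ, 0 < ε → ∃ n, ∀ Y ∈ 𝒴, Y.HasNet ε n

lemma HasNet.mono {X : MMSpace.{u}} {ε δ : ℝ} {m n : ℕ} (h : X.HasNet ε m) (hε : ε ≤ δ)
    (hmn : m ≤ n) : X.HasNet δ n := by
  obtain ⟨C, h1, h2, h3, h4, h5⟩ := h
  have : (m : ℝ) ≤ n := by exact_mod_cast hmn
  exact ⟨C, h1, fun i x hx y hy => (h2 i x hx y hy).trans hε,
    fun i x hx j y hy => (h3 i x hx j y hy).trans this, fun i hi => h4 i (hmn.trans hi),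
    by linarith⟩

lemma dist_le_of_mem_closure {α : Type*} [PseudoMetricSpace α] {A B : Set α} {r : ℝ}
    (h : ∀ x ∈ A, ∀ y ∈ B, dist x y ≤ r) {x y : α} (hx : x ∈ closure A) (hy : y ∈ closure B) :
    dist x y ≤ r := by
  have := map_mem_closure₂ (f := fun x y : α => dist x y) (u := Iic r) continuous_dist hx hy h
  rwa [isClosed_Iic.closure_eq] at this

lemma exists_hasNet (X : MMSpace.{u}) {ε : ℝ} (hε : 0 < ε) : ∃ n, X.HasNet ε n := by
  have : Nonempty X := nonempty_of_isProbabilityMeasure X.μ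
  let d := TopologicalSpace.denseSeq X
  have hd : DenseRange d := TopologicalSpace.denseRange_denseSeq X
  let U : ℕ → Set X := fun n => ⋃ i < n, closedBall (d i) (ε / 2)
  have hUm : Monotone U := fun m n hmn =>
    biUnion_subset_biUnion_left fun i hi => lt_of_lt_of_le hi hmn
  have hU : ⋃ n, U n = univ := by
    refine eq_univ_of_forall fun x => ?_
    obtain ⟨i, hi⟩ := hd.exists_dist_lt x (half_pos hε)
    exact mem_iUnion.2 ⟨i + 1, mem_iUnion₂.2 ⟨i, i.lt_succ_self, hi.le⟩⟩
  have hlim : Tendsto (fun n => X.μ.real (U n)) atTop (𝓝 1) := by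
    have := tendsto_measure_iUnion_atTop (μ := X.μ) hUm
    rw [hU, measure_univ] at this
    exact (ENNReal.tendsto_toReal ENNReal.one_ne_top).comp this
  obtain ⟨m, hm⟩ := ((tendsto_order.1 hlim).1 (1 - ε) (by linarith)).exists
  -- Two centres are at most `2 * Δ` apart via `d 0`, and the two radii add `ε`.
  let Δ := ∑ i ∈ Finset.range m, dist (d i) (d 0)
  have hΔ : ∀ i < m, dist (d i) (d 0) ≤ Δ := fun i hi =>
    Finset.single_le_sum (f := fun i => dist (d i) (d 0)) (fun _ _ => dist_nonneg)
      (Finset.mem_range.2 hi)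
  obtain ⟨n, hn⟩ := exists_nat_ge (2 * Δ + ε)
  refine ⟨max m n, fun i => {x ∈ closedBall (d i) (ε / 2) | i < m}, fun i => ?_, ?_, ?_, ?_, ?_⟩
  · exact isClosed_closedBall.inter isClosed_const
  · rintro i x ⟨hx, -⟩ y ⟨hy, -⟩
    have := dist_triangle_right x y (d i)
    rw [mem_closedBall] at hx hy
    linarith
  · rintro i x ⟨hx, hi⟩ j y ⟨hy, hj⟩
    rw [mem_closedBall] at hx hy
    have h1 := dist_triangle4_right x y (d i) (d j)
    have h2 := dist_triangle_right (d i) (d j) (d 0)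
    have h3 : (n : ℝ) ≤ (max m n : ℕ) := by exact_mod_cast le_max_right m n
    linarith [hΔ i hi, hΔ j hj]
  · intro i hi
    refine eq_empty_of_forall_notMem fun x hx => ?_
    exact absurd hx.2 (not_lt.2 ((le_max_left m n).trans hi))
  · refine hm.le.trans (measureReal_mono fun x hx => ?_)
    obtain ⟨i, hi, hx⟩ := mem_iUnion₂.1 hx
    exact mem_iUnion.2 ⟨i, hx, hi⟩

/-- Nets are transported by box-closeness. -/
lemma HasNet.of_box_lt {X Y : MMSpace.{u}} {ε δ : ℝ} {n m : ℕ} (hX : X.HasNet ε n)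
    (h : box X Y < δ) (hm : n + δ ≤ m) : Y.HasNet (ε + δ) m := by
  obtain ⟨C, h1, h2, h3, h4, h5⟩ := hX
  have hnm : n ≤ m := by
    have := (box_nonneg X Y).trans_lt h
    have : (n : ℝ) ≤ m := by linarith
    exact_mod_cast this
  obtain ⟨φ, ψ, J, hφ, hψ, hJ, hJ1, hd⟩ := exists_parameters_of_box_lt h
  refine ⟨fun i => closure (ψ '' (φ ⁻¹' C i ∩ J)), fun i => isClosed_closure, ?_, ?_, ?_, ?_⟩
  · intro i x hx y hy
    refine dist_le_of_mem_closure ?_ hx hy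
    rintro _ ⟨s, hs, rfl⟩ _ ⟨t, ht, rfl⟩
    linarith [h2 i _ hs.1 _ ht.1, (abs_le.1 (hd s hs.2 t ht.2)).1]
  · intro i x hx j y hy
    refine dist_le_of_mem_closure ?_ hx hy
    rintro _ ⟨s, hs, rfl⟩ _ ⟨t, ht, rfl⟩
    linarith [h3 i _ hs.1 j _ ht.1, (abs_le.1 (hd s hs.2 t ht.2)).1]
  · intro i hi
    simp [h4 i (hnm.trans hi)]
  · have hC : MeasurableSet (⋃ i, C i) := .iUnion fun i => (h1 i).measurableSet
    have hC' : MeasurableSet (⋃ i, closure (ψ '' (φ ⁻¹' C i ∩ J))) :=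
      .iUnion fun i => isClosed_closure.measurableSet
    rw [measureReal_def, ← hφ.measure_preimage hC.nullMeasurableSet] at h5
    refine (one_sub_add_le_measureReal_inter hJ h5 hJ1).trans ?_
    rw [measureReal_def Y.μ, ← hψ.measure_preimage hC'.nullMeasurableSet]
    refine measureReal_mono ?_
    rintro t ⟨ht, htJ⟩
    obtain ⟨i, hi⟩ := mem_iUnion.1 ht
    exact mem_iUnion.2 ⟨i, subset_closure ⟨t, ⟨hi, htJ⟩, rfl⟩⟩

/-- Prokhorov closeness compares a set only with its thickening, so the images `f (C i ∩ D)` are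
thickened; radius `2 * ε` turns the bound `≤ ε` into a strict one. Distances grow by `ε` under `f`
and by `4 * ε` from the thickenings; the lost mass is at most `ε + ε + 2 * ε`. -/
lemma HasNet.of_almostDominates {X Y : MMSpace.{u}} {ε : ℝ} (hε : 0 < ε) {n m : ℕ}
    (hX : X.HasNet ε n) (h : AlmostDominates ε X Y) (hm : n + 5 * ε ≤ m) : Y.HasNet (6 * ε) m := by
  obtain ⟨C, h1, h2, h3, h4, h5⟩ := hX
  have hnm : n ≤ m := by
    have : (n : ℝ) ≤ m := by linarith
    exact_mod_cast this
  obtain ⟨D, f, hD, hf, hD1, hd, hLP⟩ := h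
  have key : ∀ (r : ℝ) (i j : ℕ), (∀ x ∈ C i, ∀ y ∈ C j, dist x y ≤ r) →
      ∀ x ∈ closure (thickening (2 * ε) (f '' (C i ∩ D))),
      ∀ y ∈ closure (thickening (2 * ε) (f '' (C j ∩ D))), dist x y ≤ r + 5 * ε := by
    intro r i j hr x hx y hy
    refine dist_le_of_mem_closure ?_ hx hy
    intro x hx y hy
    obtain ⟨_, ⟨s, hs, rfl⟩, hxs⟩ := mem_thickening_iff.1 hx
    obtain ⟨_, ⟨t, ht, rfl⟩, hyt⟩ := mem_thickening_iff.1 hy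
    linarith [hr s hs.1 t ht.1, hd s hs.2 t ht.2, dist_triangle4_right x y (f s) (f t)]
  refine ⟨fun i => closure (thickening (2 * ε) (f '' (C i ∩ D))), fun i => isClosed_closure,
    ?_, ?_, ?_, ?_⟩
  · intro i x hx y hy
    linarith [key ε i i (h2 i) x hx y hy]
  · intro i x hx j y hy
    linarith [key n i j (fun x hx y hy => h3 i x hx j y hy) x hx y hy]
  · intro i hi
    simp [h4 i (hnm.trans hi)]
  · have hprob := Measure.isProbabilityMeasure_map (μ := X.μ) hf.aemeasurable
    have hlt : levyProkhorovEDist (X.μ.map f) Y.μ < ENNReal.ofReal (2 * ε) := by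
      rw [ENNReal.lt_ofReal_iff_toReal_lt (by simp)]
      exact hLP.trans_lt (by linarith)
    have hB := left_measure_le_of_levyProkhorovEDist_lt hlt
      (isClosed_closure (s := ⋃ i, f '' (C i ∩ D))).measurableSet
    rw [ENNReal.toReal_ofReal (by positivity), thickening_closure, thickening_iUnion] at hB
    have hB' := ENNReal.toReal_mono (ENNReal.add_ne_top.2 ⟨by simp, ENNReal.ofReal_ne_top⟩) hB
    rw [ENNReal.toReal_add (by simp) ENNReal.ofReal_ne_top, ENNReal.toReal_ofReal (by positivity),
      ← measureReal_def, ← measureReal_def,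
      map_measureReal_apply hf isClosed_closure.measurableSet] at hB'
    have e1 := one_sub_add_le_measureReal_inter hD h5 hD1
    have e2 : X.μ.real ((⋃ i, C i) ∩ D) ≤ X.μ.real (f ⁻¹' closure (⋃ i, f '' (C i ∩ D))) := by
      refine measureReal_mono ?_
      rintro x ⟨hx, hxD⟩
      obtain ⟨i, hi⟩ := mem_iUnion.1 hx
      exact subset_closure (mem_iUnion.2 ⟨i, x, ⟨hi, hxD⟩, rfl⟩)
    have e3 : Y.μ.real (⋃ i, thickening (2 * ε) (f '' (C i ∩ D))) ≤
        Y.μ.real (⋃ i, closure (thickening (2 * ε) (f '' (C i ∩ D)))) :=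
      measureReal_mono (iUnion_mono fun i => subset_closure)
    linarith

lemma hasUniformNets_of_almostDominates {𝒴 : Set MMSpace.{u}}
    (h : ∀ ε : ℝ, 0 < ε → ∃ X : MMSpace.{u}, ∀ Y ∈ 𝒴, AlmostDominates ε X Y) :
    HasUniformNets 𝒴 := by
  intro ε hε
  obtain ⟨X, hX⟩ := h (ε / 6) (by positivity)
  obtain ⟨n, hn⟩ := X.exists_hasNet (ε := ε / 6) (by positivity)
  obtain ⟨m, hm⟩ := exists_nat_ge (n + 5 * (ε / 6))
  refine ⟨m, fun Y hY => ?_⟩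
  have := hn.of_almostDominates (by positivity) (hX Y hY) hm
  exact this.mono (by linarith) le_rfl

lemma IsBoxPrecompact.hasUniformNets {𝒴 : Set MMSpace.{u}} (h : IsBoxPrecompact 𝒴) :
    HasUniformNets 𝒴 := by
  intro ε hε
  obtain ⟨t, -, ht, hcov⟩ := IsCompact.finite_cover_balls h (half_pos hε)
  have hev : ∀ X ∈ t, ∀ᶠ n in atTop, X.HasNet (ε / 2) n := fun X _ => by
    obtain ⟨n, hn⟩ := X.exists_hasNet (half_pos hε)
    exact eventually_atTop.2 ⟨n, fun m hm => hn.mono le_rfl hm⟩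
  obtain ⟨n, hn⟩ := ((eventually_all_finite ht).2 hev).exists
  obtain ⟨m, hm⟩ := exists_nat_ge (n + ε / 2)
  refine ⟨m, fun Y hY => ?_⟩
  obtain ⟨X, hX, hXY⟩ := mem_iUnion₂.1 (hcov (subset_closure hY))
  rw [mem_ball, dist_comm] at hXY
  exact ((hn X hX).of_box_lt hXY hm).mono (by linarith) le_rfl

/-! ### Spaces dominated by a fixed mm-space -/

lemma Dominates.almostDominates {X Y : MMSpace.{u}} (h : X.Dominates Y) {ε : ℝ} (hε : 0 ≤ ε) :
    AlmostDominates ε X Y := by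
  obtain ⟨f, hf, hfμ⟩ := h
  refine ⟨univ, f, .univ, hf.continuous.measurable, by simpa using hε, fun x _ y _ => ?_, ?_⟩
  · have := hf.dist_le_mul x y
    simp only [NNReal.coe_one, one_mul] at this
    linarith
  · rw [hfμ, levyProkhorovDist_self]
    exact hε

/-- The pseudodistances on an mm-space that are bounded by its distance. -/
def pseudoDists (X : MMSpace.{u}) : Set (X → X → ℝ) :=
  {ρ | (∀ x, ρ x x = 0) ∧ (∀ x y, ρ x y = ρ y x) ∧ (∀ x y z, ρ x z ≤ ρ x y + ρ y z) ∧
    ∀ x y, ρ x y ∈ Icc 0 (dist x y)}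

lemma isCompact_pseudoDists (X : MMSpace.{u}) : IsCompact X.pseudoDists := by
  have hK : IsCompact (univ.pi fun x : X => univ.pi fun y : X => Icc 0 (dist x y)) :=
    isCompact_univ_pi fun x => isCompact_univ_pi fun y => isCompact_Icc
  refine hK.of_isClosed_subset ?_ fun ρ hρ x _ y _ => hρ.2.2.2 x y
  have hc : ∀ x y : X, Continuous fun ρ : X → X → ℝ => ρ x y := fun x y => by fun_prop
  simp only [pseudoDists, ofPred_and, ofPred_forall]
  refine .inter (isClosed_iInter fun x => isClosed_eq (hc x x) continuous_const) (.inter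
    (isClosed_iInter fun x => isClosed_iInter fun y => isClosed_eq (hc x y) (hc y x)) (.inter
    (isClosed_iInter fun x => isClosed_iInter fun y => isClosed_iInter fun z =>
      isClosed_le (hc x z) ((hc x y).add (hc y z))) ?_))
  exact isClosed_iInter fun x => isClosed_iInter fun y => isClosed_Icc.preimage (hc x y)

/-- This equicontinuity upgrades closeness at finitely many net points to uniform closeness on the
whole net. -/
lemma abs_sub_le_of_mem_pseudoDists {X : MMSpace.{u}} {ρ : X → X → ℝ} (hρ : ρ ∈ X.pseudoDists)
    (x y a b : X) : |ρ x y - ρ a b| ≤ dist x a + dist y b := by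
  obtain ⟨-, h2, h3, h4⟩ := hρ
  rw [abs_le]
  have := h3 x a y
  have := h3 a b y
  have := h3 a x b
  have := h3 x y b
  have := h2 a x
  have := h2 b y
  have := (h4 x a).2
  have := (h4 y b).2
  constructor <;> linarith

/-- The mm-space obtained from a smaller pseudodistance. -/
lemma exists_mmspace_of_mem_pseudoDists {X : MMSpace.{u}} {ρ : X → X → ℝ}
    (hρ : ρ ∈ X.pseudoDists) :
    ∃ (Z : MMSpace.{u}) (q : X → Z), MeasurePreserving q X.μ Z.μ ∧
      ∀ x y, dist (q x) (q y) = ρ x y := by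
  obtain ⟨h1, h2, h3, h4⟩ := hρ
  have : Nonempty X := nonempty_of_isProbabilityMeasure X.μ
  obtain ⟨Z, q, hq, hd, -⟩ := exists_mmspace_of_pseudoDist X.μ ρ h1 h2 h3 fun ε hε =>
    ⟨fun i => closedBall (TopologicalSpace.denseSeq X i) (ε / 2),
      fun i => isClosed_closedBall.measurableSet, fun x => by
        obtain ⟨i, hi⟩ := (TopologicalSpace.denseRange_denseSeq X).exists_dist_lt x (half_pos hε)
        exact ⟨i, hi.le⟩, fun i x hx y hy => by
        rw [mem_closedBall] at hx hy
        linarith [(h4 x y).2, dist_triangle_right x y (TopologicalSpace.denseSeq X i)]⟩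
  exact ⟨Z, q, hq, hd⟩

/-- The family of all mm-spaces dominated by a given one is box-precompact. -/
lemma isBoxPrecompact_of_dominates {X : MMSpace.{u}} {𝒴 : Set MMSpace.{u}}
    (h : ∀ Y ∈ 𝒴, X.Dominates Y) : IsBoxPrecompact 𝒴 := by
  choose Z q hq hd using fun ρ : X.pseudoDists => exists_mmspace_of_mem_pseudoDists ρ.2
  have : CompactSpace X.pseudoDists := isCompact_iff_compactSpace.1 X.isCompact_pseudoDists
  have : Nonempty X := nonempty_of_isProbabilityMeasure X.μ
  have hZ : Continuous Z := by
    refine continuous_iff_continuousAt.2 fun ρ => Metric.tendsto_nhds.2 fun ε hε => ?_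
    obtain ⟨n, C, hC1, hC2, -, hC4, hC5⟩ := X.exists_hasNet (ε := ε / 6) (by positivity)
    have hp : ∀ i, ∃ x : X, ∀ y ∈ C i, dist y x ≤ ε / 6 := fun i => by
      rcases (C i).eq_empty_or_nonempty with h | ⟨x, hx⟩
      · exact ⟨Classical.arbitrary X, by simp [h]⟩
      · exact ⟨x, fun y hy => hC2 i y hy x hx⟩
    choose p hp using hp
    have hev : ∀ i < n, ∀ j < n, ∀ᶠ σ in 𝓝 ρ, |σ.1 (p i) (p j) - ρ.1 (p i) (p j)| < ε / 6 := by
      intro i _ j _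
      have hc : Continuous fun σ : X.pseudoDists => σ.1 (p i) (p j) :=
        (continuous_apply_apply (p i) (p j)).comp continuous_subtype_val
      exact Metric.tendsto_nhds.1 hc.continuousAt (ε / 6) (by positivity)
    have hev' : ∀ᶠ σ in 𝓝 ρ, ∀ i < n, ∀ j < n, |σ.1 (p i) (p j) - ρ.1 (p i) (p j)| < ε / 6 :=
      (eventually_all_finite (finite_lt_nat n)).2 fun i hi =>
        (eventually_all_finite (finite_lt_nat n)).2 fun j hj => hev i hi j hj
    filter_upwards [hev'] with σ hσ
    -- Moving to the base points costs `2 * (ε / 6)` for each of `σ` and `ρ`; at the base points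
    -- they differ by less than `ε / 6`.
    refine lt_of_le_of_lt (b := 5 * (ε / 6)) ?_ (by linarith)
    refine box_le_of_measurePreserving (hq σ) (hq ρ) (S := ⋃ i, C i)
      (.iUnion fun i => (hC1 i).measurableSet) (by positivity) (by linarith) ?_
    intro x hx y hy
    obtain ⟨i, hi⟩ := mem_iUnion.1 hx
    obtain ⟨j, hj⟩ := mem_iUnion.1 hy
    have hlt : ∀ i x, x ∈ C i → i < n := fun i x hx => by
      by_contra hn
      simp [hC4 i (not_lt.1 hn)] at hx
    have e1 := abs_sub_le_of_mem_pseudoDists σ.2 x y (p i) (p j)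
    have e2 := abs_sub_le_of_mem_pseudoDists ρ.2 x y (p i) (p j)
    have e3 := hσ i (hlt i x hi) j (hlt j y hj)
    have e4 := hp i x hi
    have e5 := hp j y hj
    rw [hd, hd]
    rw [abs_le] at e1 e2 ⊢
    rw [abs_lt] at e3
    constructor <;> linarith
  -- `Y` is only at box distance zero from some `Z ρ`, so it lies in the closure of the range, not
  -- necessarily in the range.
  refine (isCompact_range hZ).closure.of_isClosed_subset isClosed_closure
    (closure_minimal (fun Y hY => ?_) isClosed_closure)
  obtain ⟨f, hf, hfμ⟩ := h Y hY
  let ρ : X.pseudoDists := ⟨fun x y => dist (f x) (f y), fun x => dist_self _,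
    fun x y => dist_comm _ _, fun x y z => dist_triangle _ _ _,
    fun x y => ⟨dist_nonneg, by simpa using hf.dist_le_mul x y⟩⟩
  refine Metric.mem_closure_iff.2 fun ε hε => ⟨Z ρ, mem_range_self _, lt_of_le_of_lt ?_ hε⟩
  refine box_le_of_measurePreserving ⟨hf.continuous.measurable, hfμ⟩ (hq ρ) .univ le_rfl
    (by simp) fun x _ y _ => ?_
  rw [hd]
  simp [ρ]

/-! ### Splitting measures into trees of pieces -/

/-- Complements reverse the inequality on open sets, and the open thickenings of a closed set have
measures tending to its own. -/
lemma measure_eq_of_forall_isClosed_le {α : Type*} [MetricSpace α] [MeasurableSpace α]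
    [BorelSpace α] {μ ν : Measure α} [IsProbabilityMeasure μ] [IsProbabilityMeasure ν]
    (h : ∀ F, IsClosed F → μ F ≤ ν F) : μ = ν := by
  have hopen : ∀ U, IsOpen U → ν U ≤ μ U := fun U hU => by
    have h1 := h Uᶜ hU.isClosed_compl
    rw [prob_compl_eq_one_sub hU.measurableSet, prob_compl_eq_one_sub hU.measurableSet] at h1
    exact (ENNReal.sub_le_sub_iff_left prob_le_one ENNReal.one_ne_top).1 h1
  refine ext_of_generate_finite _ (BorelSpace.measurable_eq.trans borel_eq_generateFrom_isClosed)
    isPiSystem_isClosed (fun F hF => le_antisymm (h F hF) ?_) (by simp)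
  refine ge_of_tendsto (tendsto_measure_thickening_of_isClosed (μ := μ)
    ⟨1, one_pos, measure_ne_top _ _⟩ hF) ?_
  filter_upwards [self_mem_nhdsWithin] with r hr
  exact (measure_mono (self_subset_thickening hr F)).trans (hopen _ isOpen_thickening)

/-- Splitting a measure into pieces of equal mass, all but `R` of which are concentrated in one of
the sets `C i`. -/
lemma exists_measure_split {α : Type*} [MeasurableSpace α] {C : ℕ → Set α}
    (hC : ∀ i, MeasurableSet (C i)) {N R : ℕ} (hN : ∀ i, N ≤ i → C i = ∅) {t δ : ENNReal}
    (ht : t ≠ ⊤) (ht0 : t ≠ 0) (hR : N * t + δ ≤ R * t) (m : ℕ) (ν : Measure α)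
    (hν : ν univ = m * t) (hδ : ν (⋃ i, C i)ᶜ ≤ δ) :
    ∃ κ : ℕ → Measure α, (∀ j < m, κ j univ = t) ∧ ∑ j ∈ Finset.range m, κ j = ν ∧
      ∀ j < m, R ≤ j → ∃ i, κ j (C i)ᶜ = 0 := by
  induction m generalizing ν with
  | zero =>
    have : ν = 0 := Measure.measure_univ_eq_zero.1 (by simpa using hν)
    exact ⟨0, by simp, by simp [this], by simp⟩
  | succ m ih =>
    -- With at most `R` pieces left, nothing is required of them and equal multiples of `ν` do.
    -- Otherwise some `C i` has mass at least `t`, since the total exceeds `N * t + δ`, and a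
    -- multiple of `ν` restricted to it is split off as the last piece.
    rcases lt_or_ge m R with hm | hm
    · have h0 : ((m + 1 : ℕ) : ENNReal) ≠ 0 := by simp
      have h1 : ((m + 1 : ℕ) : ENNReal) ≠ ⊤ := ENNReal.natCast_ne_top _
      refine ⟨fun _ => ((m + 1 : ℕ) : ENNReal)⁻¹ • ν, fun j _ => ?_, ?_, fun j hj hRj => ?_⟩
      · rw [Measure.smul_apply, hν, smul_eq_mul, ← mul_assoc, ENNReal.inv_mul_cancel h0 h1, one_mul]
      · rw [Finset.sum_const, Finset.card_range, ← Nat.cast_smul_eq_nsmul ENNReal, smul_smul,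
          ENNReal.mul_inv_cancel h0 h1, one_smul]
      · omega
    · have hfin : ν univ ≠ ⊤ := by rw [hν]; finiteness
      have hpig : ∃ i, t ≤ ν (C i) := by
        by_contra! hlt
        have hU : ν (⋃ i, C i) ≤ N * t := by
          have : (⋃ i, C i) ⊆ ⋃ i ∈ Finset.range N, C i := by
            refine iUnion_subset fun i x hx => ?_
            have : i < N := by
              by_contra hn
              simp [hN i (not_lt.1 hn)] at hx
            exact mem_biUnion (Finset.mem_coe.2 (Finset.mem_range.2 this)) hx
          calc ν (⋃ i, C i) ≤ ∑ i ∈ Finset.range N, ν (C i) :=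
                (measure_mono this).trans (measure_biUnion_finset_le _ _)
            _ ≤ ∑ i ∈ Finset.range N, t := Finset.sum_le_sum fun i _ => (hlt i).le
            _ = N * t := by simp
        have h1 : ν univ ≤ R * t := by
          rw [← union_compl_self (⋃ i, C i)]
          exact (measure_union_le _ _).trans ((add_le_add hU hδ).trans hR)
        rw [hν] at h1
        have h2 : ((m + 1 : ℕ) : ENNReal) ≤ R := (ENNReal.mul_le_mul_iff_left ht0 ht).1 h1
        have : m + 1 ≤ R := by exact_mod_cast h2
        omega
      obtain ⟨i, hi⟩ := hpig
      have hCi0 : ν (C i) ≠ 0 := fun h => ht0 (by simpa [h] using hi)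
      have hCit : ν (C i) ≠ ⊤ := ne_top_of_le_ne_top hfin (measure_mono (subset_univ _))
      have ha : t / ν (C i) ≤ 1 := ENNReal.div_le_of_le_mul (by simpa using hi)
      have hsum : (ν.restrict (C i)ᶜ + (1 - t / ν (C i)) • ν.restrict (C i)) +
          (t / ν (C i)) • ν.restrict (C i) = ν := by
        rw [add_assoc, ← add_smul, tsub_add_cancel_of_le ha, one_smul,
          Measure.restrict_compl_add_restrict (hC i)]
      have hmass : ((t / ν (C i)) • ν.restrict (C i)) univ = t := by
        simp [ENNReal.div_mul_cancel hCi0 hCit]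
      have hle : ν.restrict (C i)ᶜ + (1 - t / ν (C i)) • ν.restrict (C i) ≤ ν := by
        conv_rhs => rw [← hsum]
        exact Measure.le_add_right le_rfl
      obtain ⟨κ, h1, h2, h3⟩ := ih (ν.restrict (C i)ᶜ + (1 - t / ν (C i)) • ν.restrict (C i))
        (by
          have := congrArg (fun ξ : Measure α => ξ univ) hsum
          simp only [Measure.add_apply _ ((t / ν (C i)) • ν.restrict (C i)), hmass, hν] at this
          push_cast at this
          rw [add_mul, one_mul] at this
          exact (ENNReal.add_left_inj ht).1 this) ((hle _).trans hδ)
      refine ⟨Function.update κ m ((t / ν (C i)) • ν.restrict (C i)), fun j hj => ?_, ?_,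
        fun j hj hRj => ?_⟩
      · rcases eq_or_ne j m with rfl | hjm
        · rw [Function.update_self, hmass]
        · rw [Function.update_of_ne hjm]; exact h1 j (by omega)
      · rw [Finset.sum_range_succ, Function.update_self, Finset.sum_congr rfl fun j hj => by
          rw [Function.update_of_ne (Finset.mem_range.1 hj).ne], h2, hsum]
      · rcases eq_or_ne j m with rfl | hjm
        · refine ⟨i, ?_⟩
          rw [Function.update_self, Measure.smul_apply, Measure.restrict_apply (hC i).compl]
          simp
        · rw [Function.update_of_ne hjm]; exact h3 j (by omega) hRj

/-- A node `w` of the next generation has parent `w / M` and last digit `w % M`. -/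
lemma sum_range_mul_div_mod {A : Type*} [AddCommMonoid A] (f : ℕ → ℕ → A) (T : ℕ) {M : ℕ}
    (hM : 0 < M) : ∑ w ∈ Finset.range (T * M), f (w / M) (w % M) =
      ∑ w ∈ Finset.range T, ∑ j ∈ Finset.range M, f w j := by
  induction T with
  | zero => simp
  | succ T ih =>
    rw [Finset.sum_range_succ, ← ih, add_mul, one_mul, Finset.sum_range_add]
    congr 1
    refine Finset.sum_congr rfl fun j hj => ?_
    have hj := Finset.mem_range.1 hj
    rw [mul_comm T M, Nat.mul_add_div hM, Nat.mul_add_mod, Nat.div_eq_of_lt hj, Nat.mod_eq_of_lt hj,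
      add_zero]

/-- A tree of measures: `ν k w`, for `w < T k`, are the pieces of generation `k` of `μ`; a piece of
generation `k + 1` with last digit at least `R k` is concentrated in one of the sets `C k i`. -/
structure IsMeasureTree {α : Type*} [MeasurableSpace α] (μ : Measure α) (T M R : ℕ → ℕ)
    (C : ℕ → ℕ → Set α) (ν : ℕ → ℕ → Measure α) : Prop where
  mass : ∀ k, ∀ w < T k, ν k w univ = (T k : ENNReal)⁻¹
  sum : ∀ k, ∑ w ∈ Finset.range (T k), ν k w = μ
  le : ∀ k, ∀ w < T (k + 1), ν (k + 1) w ≤ ν k (w / M k)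
  concentrated : ∀ k, ∀ w < T (k + 1), R k ≤ w % M k → ∃ i, ν (k + 1) w (C k i)ᶜ = 0

/-- Every piece is at most `μ`, so its mass outside the net is at most `δ k` and
`exists_measure_split` applies to all pieces of generation `k` with the same constants. -/
lemma exists_isMeasureTree {α : Type*} [MeasurableSpace α] (μ : Measure α)
    [IsProbabilityMeasure μ] {T M R N : ℕ → ℕ} {C : ℕ → ℕ → Set α}
    (hC : ∀ k i, MeasurableSet (C k i)) (hN : ∀ k i, N k ≤ i → C k i = ∅) (hT0 : T 0 = 1)
    (hT : ∀ k, T (k + 1) = T k * M k) (hM : ∀ k, 0 < M k) {δ : ℕ → ENNReal}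
    (hR : ∀ k, N k * (T (k + 1) : ENNReal)⁻¹ + δ k ≤ R k * (T (k + 1) : ENNReal)⁻¹)
    (hδ : ∀ k, μ (⋃ i, C k i)ᶜ ≤ δ k) : ∃ ν, IsMeasureTree μ T M R C ν := by
  have hTpos : ∀ k, 0 < T k := fun k => by
    induction k with
    | zero => simp [hT0]
    | succ k ih => rw [hT]; exact Nat.mul_pos ih (hM k)
  let Q : ℕ → (ℕ → Measure α) → Prop := fun k ξ =>
    (∀ w < T k, ξ w univ = (T k : ENNReal)⁻¹) ∧ ∑ w ∈ Finset.range (T k), ξ w = μ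
  have step : ∀ k (ξ : {ξ // Q k ξ}), ∃ ζ : {ζ // Q (k + 1) ζ},
      (∀ w < T (k + 1), ζ.1 w ≤ ξ.1 (w / M k)) ∧
      ∀ w < T (k + 1), R k ≤ w % M k → ∃ i, ζ.1 w (C k i)ᶜ = 0 := by
    rintro k ⟨ξ, h1, h2⟩
    have hsplit : ∀ w, ∃ κ : ℕ → Measure α, w < T k →
        (∀ j < M k, κ j univ = (T (k + 1) : ENNReal)⁻¹) ∧ ∑ j ∈ Finset.range (M k), κ j = ξ w ∧
          ∀ j < M k, R k ≤ j → ∃ i, κ j (C k i)ᶜ = 0 := by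
      intro w
      by_cases hw : w < T k
      · have hle : ξ w ≤ μ := by
          rw [← h2]
          exact Finset.single_le_sum (f := ξ) (fun _ _ => Measure.zero_le _)
            (Finset.mem_range.2 hw)
        obtain ⟨κ, hκ⟩ := exists_measure_split (hC k) (hN k) (t := (T (k + 1) : ENNReal)⁻¹)
          (by simp [(hTpos _).ne']) (by simp) (hR k) (M k) (ξ w) (by
            rw [h1 w hw, hT, Nat.cast_mul, ENNReal.mul_inv (by simp) (by simp), mul_left_comm,
              ENNReal.mul_inv_cancel (by simp [(hM k).ne']) (by simp), mul_one])
          ((hle _).trans (hδ k))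
        exact ⟨κ, fun _ => hκ⟩
      · exact ⟨0, fun h => absurd h hw⟩
    choose κ hκ using hsplit
    have hdiv : ∀ w < T (k + 1), w / M k < T k := fun w hw => by
      rw [hT] at hw
      exact Nat.div_lt_of_lt_mul (by rwa [mul_comm])
    have hmod : ∀ w, w % M k < M k := fun w => Nat.mod_lt _ (hM k)
    refine ⟨⟨fun w => κ (w / M k) (w % M k), fun w hw => (hκ _ (hdiv w hw)).1 _ (hmod w), ?_⟩,
      fun w hw => ?_, fun w hw => (hκ _ (hdiv w hw)).2.2 _ (hmod w)⟩
    · rw [hT, sum_range_mul_div_mod _ _ (hM k), ← h2]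
      exact Finset.sum_congr rfl fun w hw => (hκ w (Finset.mem_range.1 hw)).2.1
    · change κ (w / M k) (w % M k) ≤ ξ (w / M k)
      rw [← (hκ _ (hdiv w hw)).2.1]
      exact Finset.single_le_sum (f := κ (w / M k)) (fun _ _ => Measure.zero_le _)
        (Finset.mem_range.2 (hmod w))
  choose s hs using step
  let ν : ∀ k, {ξ // Q k ξ} := fun k =>
    Nat.rec ⟨fun _ => μ, by simp [hT0], by simp [hT0]⟩ (fun k ξ => s k ξ) k
  exact ⟨fun k => (ν k).1, fun k => (ν k).2.1, fun k => (ν k).2.2,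
    fun k => (hs k (ν k)).1, fun k => (hs k (ν k)).2⟩

/-! ### Mixed radix digits of points of the unit interval -/

lemma measurable_floor_mul (T : ℕ) : Measurable fun x : ℝ => ⌊T * x⌋₊ :=
  Nat.measurable_floor.comp (measurable_const.mul measurable_id)

lemma volume_floor_eq {T w : ℕ} (hw : w < T) :
    volume.restrict (Ico (0 : ℝ) 1) ((fun x : ℝ => ⌊T * x⌋₊) ⁻¹' {w}) = (T : ENNReal)⁻¹ := by
  have hT : (0 : ℝ) < T := by exact_mod_cast (Nat.zero_le w).trans_lt hw
  have hw' : (w : ℝ) + 1 ≤ T := by exact_mod_cast hw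
  have hset : (fun x : ℝ => ⌊T * x⌋₊) ⁻¹' {w} ∩ Ico (0 : ℝ) 1 =
      Ico ((w : ℝ) / T) ((w + 1) / T) := by
    ext x
    simp only [mem_inter_iff, mem_preimage, mem_singleton_iff, mem_Ico, div_le_iff₀ hT,
      lt_div_iff₀ hT]
    constructor
    · rintro ⟨h, h0, h1⟩
      rw [Nat.floor_eq_iff (by positivity)] at h
      constructor <;> linarith
    · rintro ⟨h0, h1⟩
      have hw0 : (0 : ℝ) ≤ w := by positivity
      have hx0 : 0 ≤ x := by
        by_contra hx
        nlinarith
      refine ⟨?_, hx0, ?_⟩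
      · rw [Nat.floor_eq_iff (by positivity)]
        constructor <;> linarith
      · by_contra hx
        nlinarith
  rw [Measure.restrict_apply (measurable_floor_mul T (measurableSet_singleton w)), hset,
    Real.volume_Ico, ← sub_div, add_sub_cancel_left, one_div,
    ENNReal.ofReal_inv_of_pos hT, ENNReal.ofReal_natCast]

lemma floor_lt_of_mem_Ico {T : ℕ} (hT : 0 < T) {x : ℝ} (hx : x ∈ Ico (0 : ℝ) 1) :
    ⌊T * x⌋₊ < T := by
  have hT' : (0 : ℝ) < T := by exact_mod_cast hT
  rw [Nat.floor_lt (mul_nonneg hT'.le hx.1)]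
  nlinarith [hx.2]

open Classical in
lemma volume_floor_mem {T : ℕ} (hT : 0 < T) (A : Set ℕ) :
    volume.restrict (Ico (0 : ℝ) 1) ((fun x : ℝ => ⌊T * x⌋₊) ⁻¹' A) =
      ∑ w ∈ Finset.range T, if w ∈ A then (T : ENNReal)⁻¹ else 0 := by
  have h1 : volume.restrict (Ico (0 : ℝ) 1) ((fun x : ℝ => ⌊T * x⌋₊) ⁻¹' A) =
      volume.restrict (Ico (0 : ℝ) 1) ((fun x : ℝ => ⌊T * x⌋₊) ⁻¹'
        ((Finset.range T).filter (· ∈ A) : Finset ℕ)) := by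
    refine measure_congr ?_
    filter_upwards [ae_restrict_mem measurableSet_Ico] with x hx
    refine propext ?_
    change ⌊T * x⌋₊ ∈ A ↔ ⌊T * x⌋₊ ∈ ((Finset.range T).filter (· ∈ A) : Finset ℕ)
    simp [floor_lt_of_mem_Ico hT hx]
  rw [h1, ← sum_measure_preimage_singleton _ fun w _ =>
    measurable_floor_mul T (measurableSet_singleton w), Finset.sum_filter]
  refine Finset.sum_congr rfl fun w hw => ?_
  split_ifs
  · exact volume_floor_eq (Finset.mem_range.1 hw)
  · rfl

/-- Points of `[0,1)` whose `k`-th digit is at least `R k` for all but finitely many `k`, with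
respect to the mixed radix expansion with radices `M k` and place values `1 / T k`. -/
def core (T M R : ℕ → ℕ) : Set ℝ :=
  {x | x ∈ Ico (0 : ℝ) 1 ∧ ∀ᶠ k in atTop, R k ≤ ⌊T (k + 1) * x⌋₊ % M k}

lemma measurableSet_digit (T M R : ℕ → ℕ) (k : ℕ) :
    MeasurableSet {x : ℝ | R k ≤ ⌊T (k + 1) * x⌋₊ % M k} :=
  measurable_floor_mul (T (k + 1)) (MeasurableSet.of_discrete (s := {w | R k ≤ w % M k}))

lemma measurableSet_core (T M R : ℕ → ℕ) : MeasurableSet (core T M R) := by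
  have : {x : ℝ | ∀ᶠ k in atTop, R k ≤ ⌊T (k + 1) * x⌋₊ % M k} =
      liminf (fun k => {x : ℝ | R k ≤ ⌊T (k + 1) * x⌋₊ % M k}) atTop := by
    ext x
    simp [mem_liminf_iff_eventually_mem]
  have hm : MeasurableSet {x : ℝ | ∀ᶠ k in atTop, R k ≤ ⌊T (k + 1) * x⌋₊ % M k} := by
    rw [this]
    exact .measurableSet_liminf fun k => measurableSet_digit T M R k
  exact measurableSet_Ico.inter hm

/-- Borel–Cantelli: at most `T k * R k` of the `T (k + 1)` words have a bad last digit, and these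
proportions are summable. -/
lemma ae_mem_core {T M R : ℕ → ℕ} (hTpos : ∀ k, 0 < T k) (hT : ∀ k, T (k + 1) = T k * M k)
    (hM : ∀ k, 0 < M k)
    (hR : ∀ k, T k * (R k * (T (k + 1) : ENNReal)⁻¹) ≤ (1 / 2 : ENNReal) ^ k) :
    ∀ᵐ x ∂volume.restrict (Ico (0 : ℝ) 1), x ∈ core T M R := by
  classical
  have hbad : ∀ k, volume.restrict (Ico (0 : ℝ) 1) ((fun x : ℝ => ⌊T (k + 1) * x⌋₊) ⁻¹'
      {w | w % M k < R k}) ≤ (1 / 2 : ENNReal) ^ k := by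
    intro k
    refine le_trans ?_ (hR k)
    rw [volume_floor_mem (hTpos _)]
    have := sum_range_mul_div_mod
      (fun _ j => if j < R k then (T (k + 1) : ENNReal)⁻¹ else 0) (T k) (hM k)
    rw [← hT] at this
    refine ((Finset.sum_congr rfl fun w _ => ?_).trans this).trans_le ?_
    · by_cases hw : w % M k < R k
      · exact (if_pos hw).trans (if_pos hw).symm
      · exact (if_neg hw).trans (if_neg hw).symm
    rw [Finset.sum_const, Finset.card_range, nsmul_eq_mul, ← Finset.sum_filter,
      Finset.sum_const, nsmul_eq_mul]
    gcongr
    calc ((Finset.range (M k)).filter (· < R k)).card ≤ (Finset.range (R k)).card :=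
          Finset.card_le_card fun j hj => by simp at hj ⊢; exact hj.2
      _ = R k := Finset.card_range _
  have hsum : ∑' k, volume.restrict (Ico (0 : ℝ) 1) ((fun x : ℝ => ⌊T (k + 1) * x⌋₊) ⁻¹'
      {w | w % M k < R k}) ≠ ⊤ := by
    refine ne_top_of_le_ne_top ?_ (ENNReal.tsum_le_tsum hbad)
    rw [ENNReal.tsum_geometric]
    simp
  filter_upwards [ae_restrict_mem measurableSet_Ico, ae_eventually_notMem hsum] with x hx h
  exact ⟨hx, h.mono fun k hk => not_lt.1 hk⟩

/-! ### Parameters from measure trees and the common dominating space -/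

/-- A tree of measures yields a map from `[0,1)` with controlled oscillation, which pushes Lebesgue
measure forward to the given measure. -/
lemma IsMeasureTree.exists_map {α : Type*} [MetricSpace α] [CompleteSpace α]
    [SecondCountableTopology α] [MeasurableSpace α] [BorelSpace α] {μ : Measure α}
    {T M R : ℕ → ℕ} {C : ℕ → ℕ → Set α} {ν : ℕ → ℕ → Measure α}
    (hν : IsMeasureTree μ T M R C ν) (hC : ∀ k i, IsClosed (C k i)) {ε : ℕ → ℝ}
    (hε : Tendsto ε atTop (𝓝 0)) (hCε : ∀ k i, ∀ x ∈ C k i, ∀ y ∈ C k i, dist x y ≤ ε k)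
    (hTpos : ∀ k, 0 < T k) (hT : ∀ k, T (k + 1) = T k * M k) (hM : ∀ k, 0 < M k)
    (hcore : ∀ᵐ x ∂volume.restrict (Ico (0 : ℝ) 1), x ∈ core T M R) :
    ∃ φ : ℝ → α,
      (∀ x ∈ core T M R, ∀ y ∈ core T M R, ∀ k, R k ≤ ⌊T (k + 1) * x⌋₊ % M k →
        ⌊T (k + 1) * x⌋₊ = ⌊T (k + 1) * y⌋₊ → dist (φ x) (φ y) ≤ ε k) ∧
      (∀ x ∈ core T M R, ∀ k, R k ≤ ⌊T (k + 1) * x⌋₊ % M k → ∃ i, φ x ∈ C k i) ∧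
      ∀ F, IsClosed F → μ F ≤ volume.restrict (Ico (0 : ℝ) 1) {x | x ∈ core T M R ∧ φ x ∈ F} := by
  have hword : ∀ k (x : ℝ), ⌊T k * x⌋₊ = ⌊T (k + 1) * x⌋₊ / M k := fun k x => by
    have : (0 : ℝ) < M k := by exact_mod_cast hM k
    rw [← Nat.floor_div_natCast, hT, Nat.cast_mul]
    congr 1
    field_simp
  let S : ℕ → ℝ → Set α := fun k x => (ν k ⌊T k * x⌋₊).support
  have hSanti : ∀ x ∈ Ico (0 : ℝ) 1, Antitone fun k => S k x := fun x hx =>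
    antitone_nat_of_succ_le fun k => by
      have := hν.le k _ (floor_lt_of_mem_Ico (hTpos (k + 1)) hx)
      rw [← hword] at this
      exact Measure.support_mono this
  have hSC : ∀ x ∈ Ico (0 : ℝ) 1, ∀ k, R k ≤ ⌊T (k + 1) * x⌋₊ % M k →
      ∃ i, S (k + 1) x ⊆ C k i := fun x hx k hk => by
    obtain ⟨i, hi⟩ := hν.concentrated k _ (floor_lt_of_mem_Ico (hTpos (k + 1)) hx) hk
    exact ⟨i, Measure.support_subset_of_isClosed (hC k i) hi⟩
  have hSne : ∀ x ∈ Ico (0 : ℝ) 1, ∀ k, (S k x).Nonempty := fun x hx k => by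
    refine Measure.nonempty_support fun h => ?_
    have := hν.mass k _ (floor_lt_of_mem_Ico (hTpos k) hx)
    rw [h] at this
    exact absurd this.symm (by simp)
  have hsmall : ∀ x ∈ core T M R, ∀ r > 0, ∃ k, ∀ y ∈ S k x, ∀ z ∈ S k x, dist y z < r := by
    rintro x ⟨hx, hev⟩ r hr
    obtain ⟨k, hk, hkr⟩ := (hev.and ((tendsto_order.1 hε).2 r hr)).exists
    obtain ⟨i, hi⟩ := hSC x hx k hk
    exact ⟨k + 1, fun y hy z hz => (hCε k i y (hi hy) z (hi hz)).trans_lt hkr⟩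
  -- Cantor's intersection argument for nested closed supports of diameter tending to zero.
  have hex : ∀ x ∈ core T M R, ∃ y, ∀ k, y ∈ S k x := by
    intro x hx
    choose y hy using hSne x hx.1
    have hcauchy : CauchySeq y := Metric.cauchySeq_iff'.2 fun r hr => by
      obtain ⟨k, hk⟩ := hsmall x hx r hr
      exact ⟨k, fun n hn => hk _ (hSanti x hx.1 hn (hy n)) _ (hy k)⟩
    obtain ⟨z, hz⟩ := cauchySeq_tendsto_of_complete hcauchy
    exact ⟨z, fun k => Measure.isClosed_support.mem_of_tendsto hz
      (eventually_atTop.2 ⟨k, fun n hn => hSanti x hx.1 hn (hy n)⟩)⟩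
  have hne : Nonempty α := by
    obtain ⟨y, -⟩ := hSne 0 (by simp) 0
    exact ⟨y⟩
  have hex' : ∀ x, ∃ y, x ∈ core T M R → ∀ k, y ∈ S k x := fun x => by
    by_cases hx : x ∈ core T M R
    · obtain ⟨y, hy⟩ := hex x hx
      exact ⟨y, fun _ => hy⟩
    · exact ⟨hne.some, fun h => absurd h hx⟩
  choose φ hφ using hex'
  refine ⟨φ, fun x hx y hy k hk hxy => ?_, fun x hx k hk => ?_, fun F hF => ?_⟩
  · obtain ⟨i, hi⟩ := hSC x hx.1 k hk
    have : S (k + 1) x = S (k + 1) y := by simp only [S, hxy]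
    exact hCε k i _ (hi (hφ x hx (k + 1))) _ (hi (this ▸ hφ y hy (k + 1)))
  · obtain ⟨i, hi⟩ := hSC x hx.1 k hk
    exact ⟨i, hi (hφ x hx (k + 1))⟩
  · classical
    -- Pieces whose support misses `F` give it no mass, so `μ F` is at most the measure of `E k`.
    -- These sets decrease, and a core point in all of them has `φ x` in `F`, as `F` is closed. No
    -- measurability of `φ` is needed.
    let E : ℕ → Set ℝ := fun k => {x | (S k x ∩ F).Nonempty} ∩ Ico 0 1
    have hEeq : ∀ k, {x | (S k x ∩ F).Nonempty} =
      (fun x : ℝ => ⌊T k * x⌋₊) ⁻¹' {w | ((ν k w).support ∩ F).Nonempty} := fun k => rfl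
    have hEm : ∀ k, MeasurableSet {x | (S k x ∩ F).Nonempty} := fun k => by
      rw [hEeq]; exact measurable_floor_mul _ .of_discrete
    have hEμ : ∀ k, μ F ≤ volume.restrict (Ico (0 : ℝ) 1) (E k) := by
      intro k
      have : volume.restrict (Ico (0 : ℝ) 1) (E k) =
          volume.restrict (Ico (0 : ℝ) 1) {x | (S k x ∩ F).Nonempty} := by
        rw [Measure.restrict_apply (hEm k),
          Measure.restrict_apply ((hEm k).inter measurableSet_Ico), inter_assoc, inter_self]
      rw [this, hEeq, volume_floor_mem (hTpos k), ← hν.sum k, Measure.finsetSum_apply]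
      refine Finset.sum_le_sum fun w hw => ?_
      split_ifs with h
      · rw [← hν.mass k w (Finset.mem_range.1 hw)]
        exact measure_mono (subset_univ _)
      · refine (measure_mono_null ?_ (Measure.measure_compl_support (μ := ν k w))).le
        exact fun x hx hxs => h ⟨x, hxs, hx⟩
    have hEanti : Antitone E := fun k l hkl x hx =>
      ⟨hx.1.mono (inter_subset_inter_left _ (hSanti x hx.2 hkl)), hx.2⟩
    have hlim := tendsto_measure_iInter_atTop (μ := volume.restrict (Ico (0 : ℝ) 1))
      (fun k => ((hEm k).inter measurableSet_Ico).nullMeasurableSet) hEanti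
      ⟨0, measure_ne_top _ _⟩
    refine (ge_of_tendsto' hlim hEμ).trans (measure_mono_ae ?_)
    filter_upwards [hcore] with x hx hxE
    refine ⟨hx, hF.closure_eq ▸ Metric.mem_closure_iff.2 fun r hr => ?_⟩
    obtain ⟨k, hk⟩ := hsmall x hx r hr
    obtain ⟨z, hz, hzF⟩ := (mem_iInter.1 hxE k).1
    exact ⟨z, hzF, hk _ (hφ x hx k) z hz⟩

/-- A family of measure maps from the unit interval with uniformly controlled oscillation is
dominated by one mm-space. -/
lemma exists_dominates_of_maps {𝒴 : Set MMSpace.{u}} {T M R N : ℕ → ℕ} {ε : ℕ → ℝ}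
    (hε : Tendsto ε atTop (𝓝 0))
    (hcore : ∀ᵐ x ∂volume.restrict (Ico (0 : ℝ) 1), x ∈ core T M R)
    (h : ∀ Y ∈ 𝒴, ∃ φ : ℝ → Y,
      (∀ x ∈ core T M R, ∀ y ∈ core T M R, ∀ k, R k ≤ ⌊T (k + 1) * x⌋₊ % M k →
        ⌊T (k + 1) * x⌋₊ = ⌊T (k + 1) * y⌋₊ → dist (φ x) (φ y) ≤ ε k) ∧
      (∀ x ∈ core T M R, ∀ y ∈ core T M R, ∀ k, R k ≤ ⌊T (k + 1) * x⌋₊ % M k →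
        R k ≤ ⌊T (k + 1) * y⌋₊ % M k → dist (φ x) (φ y) ≤ N k) ∧
      ∀ F, IsClosed F →
        Y.μ F ≤ volume.restrict (Ico (0 : ℝ) 1) {x | x ∈ core T M R ∧ φ x ∈ F}) :
    ∃ X : MMSpace.{u}, ∀ Y ∈ 𝒴, X.Dominates Y := by
  classical
  let P : Measure ℝ := volume.restrict (Ico 0 1)
  have hP : IsProbabilityMeasure P := ⟨by simp [P]⟩
  choose φ h1 h2 h3 using fun Y : 𝒴 => h Y.1 Y.2
  obtain ⟨x₀, hx₀⟩ := hcore.exists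
  -- Sending all other points to one core point makes the supremum finite everywhere.
  let r : ℝ → ℝ := fun x => if x ∈ core T M R then x else x₀
  have hr : ∀ x, r x ∈ core T M R := fun x => by
    simp only [r]
    split_ifs with hx
    exacts [hx, hx₀]
  have hrm : Measurable r := measurable_id.ite (measurableSet_core T M R) measurable_const
  have hbdd : ∀ x y : ULift.{u} ℝ,
      BddAbove (range fun Y : 𝒴 => dist (φ Y (r x.down)) (φ Y (r y.down))) := fun x y => by
    -- At a generation where both digits are good, `N k` bounds the distance for all `Y` at once.
    obtain ⟨k, hk⟩ := ((hr x.down).2.and (hr y.down).2).exists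
    refine ⟨N k, ?_⟩
    rintro _ ⟨Y, rfl⟩
    exact h2 Y _ (hr _) _ (hr _) k hk.1 hk.2
  let ρ : ULift.{u} ℝ → ULift.{u} ℝ → ℝ := fun x y =>
    ⨆ Y : 𝒴, dist (φ Y (r x.down)) (φ Y (r y.down))
  have hρ : ∀ (Y : 𝒴) x y, dist (φ Y (r x.down)) (φ Y (r y.down)) ≤ ρ x y := fun Y x y =>
    le_ciSup (hbdd x y) Y
  have hρ0 : ∀ x y, 0 ≤ ρ x y := fun x y => Real.iSup_nonneg fun _ => dist_nonneg
  have hup : Measurable (ULift.up : ℝ → ULift.{u} ℝ) := measurable_up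
  have hPup : IsProbabilityMeasure (P.map (ULift.up : ℝ → ULift.{u} ℝ)) :=
    Measure.isProbabilityMeasure_map hup.aemeasurable
  obtain ⟨X, q, hq, -, hext⟩ := exists_mmspace_of_pseudoDist (P.map (ULift.up : ℝ → ULift.{u} ℝ)) ρ
    (fun x => by simp [ρ]) (fun x y => by simp only [ρ, dist_comm])
    (fun x y z => Real.iSup_le (fun Y => (dist_triangle _ _ _).trans
      (add_le_add (hρ Y x y) (hρ Y y z))) (add_nonneg (hρ0 x y) (hρ0 y z)))
    (fun δ hδ => by
      obtain ⟨K, hK⟩ := eventually_atTop.1 ((tendsto_order.1 hε).2 δ hδ)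
      have hm : Measurable fun x : ULift.{u} ℝ => r x.down := hrm.comp measurable_down
      -- The index `i` codes a generation past `K` and a word; requiring a good last digit bounds
      -- `ρ` on the set by `δ`.
      refine ⟨fun i => (fun x : ULift.{u} ℝ => r x.down) ⁻¹'
        ({y | R (K + i.unpair.1) ≤ ⌊T (K + i.unpair.1 + 1) * y⌋₊ % M (K + i.unpair.1)} ∩
          (fun y : ℝ => ⌊T (K + i.unpair.1 + 1) * y⌋₊) ⁻¹' {i.unpair.2}), fun i => ?_, fun x => ?_,
        fun i x hx y hy => ?_⟩
      · exact hm ((measurableSet_digit T M R _).inter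
          (measurable_floor_mul _ (measurableSet_singleton _)))
      · obtain ⟨k, hk, hKk⟩ := ((hr x.down).2.and (eventually_ge_atTop K)).exists
        obtain ⟨l, rfl⟩ := Nat.exists_eq_add_of_le hKk
        refine ⟨Nat.pair l ⌊T (K + l + 1) * r x.down⌋₊, ?_⟩
        simp only [Nat.unpair_pair]
        exact ⟨hk, rfl⟩
      · refine Real.iSup_le (fun Y => ?_) hδ.le
        exact (h1 Y _ (hr _) _ (hr _) _ hx.1 (hx.2.trans hy.2.symm)).trans
          (hK _ (Nat.le_add_right _ _)).le)
  refine ⟨X, fun Y hY => ?_⟩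
  obtain ⟨g, hg, hgq⟩ := hext Y (fun x => φ ⟨Y, hY⟩ (r x.down)) (hρ ⟨Y, hY⟩)
  refine ⟨g, hg, ?_⟩
  have hgm : Measurable g := hg.continuous.measurable
  have : IsProbabilityMeasure (X.μ.map g) := Measure.isProbabilityMeasure_map hgm.aemeasurable
  refine (measure_eq_of_forall_isClosed_le fun F hF => (h3 ⟨Y, hY⟩ F hF).trans ?_).symm
  rw [← hq.map_eq, Measure.map_map hgm hq.measurable,
    Measure.map_map (hgm.comp hq.measurable) hup,
    Measure.map_apply ((hgm.comp hq.measurable).comp hup) hF.measurableSet]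
  refine measure_mono fun x hx => ?_
  have hrx : r x = x := if_pos hx.1
  change g (q (ULift.up x)) ∈ F
  rw [hgq, hrx]
  exact hx.2

lemma HasUniformNets.exists_dominates {𝒴 : Set MMSpace.{u}} (h : HasUniformNets 𝒴) :
    ∃ X : MMSpace.{u}, ∀ Y ∈ 𝒴, X.Dominates Y := by
  choose! n hn using h
  obtain ⟨T, hT0, hTs⟩ : ∃ T : ℕ → ℕ, T 0 = 1 ∧ ∀ k, T (k + 1) =
      T k * (2 ^ (k + 1) * (n (1 / (2 ^ (k + 1) * (T k : ℝ))) + 1)) :=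
    ⟨fun k => Nat.rec 1 (fun k t => t * (2 ^ (k + 1) * (n (1 / (2 ^ (k + 1) * (t : ℝ))) + 1))) k,
      rfl, fun _ => rfl⟩
  -- The scale makes the exceptional mass `ε k` small even against one piece of mass `1 / T k`. With
  -- these radices it is `N k + 1` pieces of the next generation, so `R k = 2 * (N k + 1)` exceeds
  -- `N k` plus this number, while `R k / M k = 2 ^ (-k)` stays summable.
  let ε : ℕ → ℝ := fun k => 1 / (2 ^ (k + 1) * (T k : ℝ))
  let N : ℕ → ℕ := fun k => n (ε k)
  let M : ℕ → ℕ := fun k => 2 ^ (k + 1) * (N k + 1)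
  let R : ℕ → ℕ := fun k => 2 * (N k + 1)
  have hT : ∀ k, T (k + 1) = T k * M k := hTs
  have hM : ∀ k, 0 < M k := fun k => by positivity
  have hTpos : ∀ k, 0 < T k := fun k => by
    induction k with
    | zero => simp [hT0]
    | succ k ih => rw [hT]; exact Nat.mul_pos ih (hM k)
  have hTr : ∀ k, (0 : ℝ) < T k := fun k => by exact_mod_cast hTpos k
  have hεpos : ∀ k, 0 < ε k := fun k => by have := hTr k; positivity
  have hε : Tendsto ε atTop (𝓝 0) := by
    refine squeeze_zero (fun k => (hεpos k).le) (fun k => ?_)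
      (tendsto_pow_atTop_nhds_zero_of_lt_one (r := (1 / 2 : ℝ)) (by norm_num) (by norm_num))
    have h1 : (1 : ℝ) ≤ T k := by exact_mod_cast hTpos k
    rw [one_div_pow]
    refine one_div_le_one_div_of_le (by positivity) ?_
    rw [pow_succ]
    have : (0 : ℝ) < 2 ^ k := by positivity
    nlinarith
  have hεT : ∀ k, ENNReal.ofReal (ε k) = (N k + 1 : ℕ) * (T (k + 1) : ENNReal)⁻¹ := fun k => by
    rw [← ENNReal.ofReal_natCast (T (k + 1)), ← ENNReal.ofReal_inv_of_pos (hTr _),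
      ← ENNReal.ofReal_natCast (N k + 1), ← ENNReal.ofReal_mul (by positivity), hT]
    congr 1
    have := hTr k
    simp only [ε, M]
    push_cast
    field_simp
  have hcore : ∀ᵐ x ∂volume.restrict (Ico (0 : ℝ) 1), x ∈ core T M R := by
    refine ae_mem_core hTpos hT hM fun k => le_of_eq ?_
    have : (R k : ENNReal) = 2 * (N k + 1 : ℕ) := by simp only [R]; push_cast; rfl
    rw [this, mul_assoc, ← hεT, ← ENNReal.ofReal_natCast (T k), ← ENNReal.ofReal_ofNat 2,
      ← ENNReal.ofReal_mul (by positivity), ← ENNReal.ofReal_mul (by positivity),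
      show (1 : ENNReal) / ENNReal.ofReal 2 = ENNReal.ofReal (1 / 2) by
        rw [ENNReal.ofReal_div_of_pos two_pos, ENNReal.ofReal_one],
      ← ENNReal.ofReal_pow (by positivity)]
    congr 1
    have := hTr k
    simp only [ε]
    rw [pow_succ, one_div_pow]
    field_simp
  refine exists_dominates_of_maps (N := N) hε hcore fun Y hY => ?_
  choose C hC1 hC2 hC3 hC4 hC5 using fun k => hn (ε k) (hεpos k) Y hY
  obtain ⟨ν, hν⟩ := exists_isMeasureTree Y.μ (R := R) (δ := fun k => ENNReal.ofReal (ε k))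
    (fun k i => (hC1 k i).measurableSet) hC4 hT0 hT hM (fun k => by
      rw [hεT, ← add_mul, ← Nat.cast_add]
      gcongr
      simp only [N, R]
      omega) (fun k => by
      have hm : MeasurableSet (⋃ i, C k i) := .iUnion fun i => (hC1 k i).measurableSet
      rw [← ofReal_measureReal, probReal_compl_eq_one_sub hm]
      exact ENNReal.ofReal_le_ofReal (by linarith [hC5 k]))
  obtain ⟨φ, h1, h2, h3⟩ := hν.exists_map hC1 hε hC2 hTpos hT hM hcore
  refine ⟨φ, h1, fun x hx y hy k hkx hky => ?_, h3⟩
  obtain ⟨i, hi⟩ := h2 x hx k hkx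
  obtain ⟨j, hj⟩ := h2 y hy k hky
  exact hC3 k i _ hi j _ hj

end MMSpace

theorem corollary3p12 (𝒴 : Set MMSpace.{u}) :
    List.TFAE [
      ∃ X : MMSpace.{u}, ∀ Y ∈ 𝒴, X.Dominates Y,
      ∀ ε : ℝ, 0 < ε → ∃ X : MMSpace.{u}, ∀ Y ∈ 𝒴, MMSpace.AlmostDominates ε X Y,
      MMSpace.IsBoxPrecompact 𝒴] := by
  tfae_have 1 → 2 := fun ⟨X, hX⟩ ε hε => ⟨X, fun Y hY => (hX Y hY).almostDominates hε.le⟩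
  tfae_have 2 → 1 := fun h => (MMSpace.hasUniformNets_of_almostDominates h).exists_dominates
  tfae_have 1 → 3 := fun ⟨_, hX⟩ => MMSpace.isBoxPrecompact_of_dominates hX
  tfae_have 3 → 1 := fun h => h.hasUniformNets.exists_dominates
  tfae_finish
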